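/- Let $n\ge 1$ and let $\lambda=(\lambda_1>\lambda_2>\dots>\lambda_n>0)$ be a strict partition with exactly $n$ positive parts. Put $\delta=(n,n-1,\dots,1)$ and $\mu=\lambda-\delta$, a partition with at most $n$ non-zero parts. Let $x=(x_1,\dots,x_n)$, $y=(y_1,\dots,y_n)$ and $a=(a_0,a_1,a_2,\dots)$ with $a_0=0$, where $x_i,y_i,a_k$ are elements of a commutative ring (for instance, apart from $a_0$, independent indeterminates). Let $\mathcal G^\lambda$ be the set of strict Gelfand–Tsetlin patterns with top row $\lambda$, that is, of triangular arrays $G=(m_{ij})_{1\le j\le i\le n}$ of non-negative integers such that $m_{nj}=\lambda_j$ for $1\le j\le n$, $m_{ij}\ge m_{i-1,j}\ge m_{i,j+1}$ for $2\le i\le n$, $1\le j\le i-1$, and $m_{ij}>m_{i,j+1}$ for $1\le i\le n$, $1\le j\le i-1$. For a proposition $P$ let $\chi(P)$ be $1$ if $P$ is true and $0$ otherwise. For $2\le i\le n$ and $1\le j\le i-1$ let $L_{ij}$, $B_{ij}$, $R_{ij}$ be the propositions $$L_{ij}:\ m_{ij}=m_{i-1,j}>m_{i,j+1},\qquad B_{ij}:\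 m_{ij}>m_{i-1,j}>m_{i,j+1},\qquad R_{ij}:\ m_{ij}>m_{i-1,j}=m_{i,j+1},$$ and define $$\mathrm{wgt}(G)=\prod_{i=1}^n\prod_{k=0}^{m_{ii}-1}(x_i+a_k)\ \times\ \prod_{i=2}^n\prod_{j=1}^{i-1}\Big(\big(\chi(L_{ij})+\chi(B_{ij})(x_i+y_i)+\chi(R_{ij})(y_i-a_{m_{i-1,j}})\big)\prod_{k=m_{i-1,j}+1}^{m_{ij}-1}(x_i+a_k)\Big).$$ Let the factorial Schur function be $$s_\mu(x|a)=\sum_T\ \prod_{(i,j)}\big(x_{T_{ij}}+a_{T_{ij}+j-i}\big),$$ where $T$ runs over the semistandard tableaux of shape $\mu$ (rows weakly increasing, columns strictly increasing) with entries in $\{1,\dots,n\}$, and $(i,j)$ runs over the boxes (row $i$, column $j$) of $\mu$. Then $$\sum_{G\in\mathcal G^\lambda}\mathrm{wgt}(G)=\prod_{i=1}^n x_i\ \prod_{1\le i<j\le n}(x_i+y_j)\ \ s_\mu(x|a).$$ -/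

import Mathlib

/-- The staircase `δ = (n, n - 1, …, 1)`, with parts indexed by `1, …, n`. -/
def staircase (n i : ℕ) : ℕ := n + 1 - i

/-- The sequence `lam - δ`, with parts indexed by `1, …, n`. For a strict partition with `n`
positive parts no subtraction truncates, see `subStaircase_add`. -/
def subStaircase (n : ℕ) (lam : ℕ → ℕ) (i : ℕ) : ℕ := lam i - staircase n i

theorem staircase_le {n : ℕ} {lam : ℕ → ℕ} (hs : StrictAntiOn lam (Set.Icc 1 n))
    (hp : ∀ i ∈ Set.Icc 1 n, 0 < lam i) :
    ∀ i ∈ Set.Icc 1 n, staircase n i ≤ lam i := by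
  have key : ∀ d i, i + d = n → 1 ≤ i → d + 1 ≤ lam i := by
    intro d
    induction d with
    | zero => intro i hi h1; exact hp i ⟨h1, by omega⟩
    | succ d ih =>
      intro i hi h1
      have h2 := ih (i + 1) (by omega) (by omega)
      have h3 : lam (i + 1) < lam i :=
        hs ⟨h1, by omega⟩ ⟨by omega, by omega⟩ (Nat.lt_succ_self i)
      omega
  intro i hi
  have := key (n - i) i (by have := hi.2; omega) hi.1
  have := hi.2
  unfold staircase
  omega

theorem subStaircase_add {n : ℕ} {lam : ℕ → ℕ} (hs : StrictAntiOn lam (Set.Icc 1 n))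
    (hp : ∀ i ∈ Set.Icc 1 n, 0 < lam i) (i : ℕ) (hi : i ∈ Set.Icc 1 n) :
    subStaircase n lam i + staircase n i = lam i :=
  Nat.sub_add_cancel (staircase_le hs hp i hi)

theorem subStaircase_antitone {n : ℕ} {lam : ℕ → ℕ} (hs : StrictAntiOn lam (Set.Icc 1 n)) :
    AntitoneOn (subStaircase n lam) (Set.Icc 1 n) := by
  have key : ∀ d i, 1 ≤ i → i + d ≤ n → subStaircase n lam (i + d) ≤ subStaircase n lam i := by
    intro d
    induction d with
    | zero => intro i _ _; exact le_rfl
    | succ d ih =>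
      intro i h1 h2
      refine le_trans ?_ (ih i h1 (by omega))
      have h3 : lam (i + (d + 1)) < lam (i + d) :=
        hs ⟨by omega, by omega⟩ ⟨by omega, by omega⟩ (by omega)
      unfold subStaircase staircase
      omega
  intro i hi j hj hij
  have := key (j - i) i hi.1 (by have := hj.2; omega)
  rwa [Nat.add_sub_cancel' hij] at this

/-- The Young diagram of the partition `(μ 1, …, μ n)`. Mathlib indexes the rows and columns of
a Young diagram from `0`, so its row `i` has length `μ (i + 1)`. -/
def diagramOf (n : ℕ) (μ : ℕ → ℕ) (hμ : AntitoneOn μ (Set.Icc 1 n)) : YoungDiagram where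
  cells := (Finset.range n).biUnion fun i => (Finset.range (μ (i + 1))).image fun j => (i, j)
  isLowerSet := by
    rintro ⟨i, j⟩ ⟨i', j'⟩ h hc
    have h1 : i' ≤ i := h.1
    have h2 : j' ≤ j := h.2
    simp only [Finset.coe_biUnion, Finset.coe_image, Set.mem_iUnion, Set.mem_image,
      Finset.mem_coe, Finset.mem_range, Prod.mk.injEq, exists_prop] at hc ⊢
    obtain ⟨p, hp, q, hq, rfl, rfl⟩ := hc
    have h3 : μ (p + 1) ≤ μ (i' + 1) :=
      hμ ⟨by omega, by omega⟩ ⟨by omega, by omega⟩ (by omega)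
    exact ⟨i', by omega, j', by omega, rfl, rfl⟩

theorem mem_diagramOf {n : ℕ} {μ : ℕ → ℕ} (hμ : AntitoneOn μ (Set.Icc 1 n)) (i j : ℕ) :
    (i, j) ∈ diagramOf n μ hμ ↔ i < n ∧ j < μ (i + 1) := by
  rw [← YoungDiagram.mem_cells]
  simp [diagramOf]

/-- Semistandard tableaux of shape `μ` with entries in `{1, …, n}`. -/
abbrev TableauIn (μ : YoungDiagram) (n : ℕ) : Type :=
  {T : SemistandardYoungTableau μ // ∀ i j, (i, j) ∈ μ → 1 ≤ T i j ∧ T i j ≤ n}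

instance TableauIn.instFinite (μ : YoungDiagram) (n : ℕ) : Finite (TableauIn μ n) := by
  let f : TableauIn μ n → (μ.cells → Fin (n + 1)) := fun T c =>
    ⟨T.1 c.1.1 c.1.2, Nat.lt_succ_of_le (T.2 _ _ ((YoungDiagram.mem_cells (μ := μ) _).1 c.2)).2⟩
  refine Finite.of_injective f ?_
  intro T U h
  apply Subtype.ext
  apply SemistandardYoungTableau.ext
  intro i j
  by_cases hc : (i, j) ∈ μ
  · have h1 := congrFun h ⟨(i, j), (YoungDiagram.mem_cells (μ := μ) _).2 hc⟩
    exact congrArg Fin.val h1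
  · rw [T.1.zeros hc, U.1.zeros hc]

noncomputable instance TableauIn.instFintype (μ : YoungDiagram) (n : ℕ) :
    Fintype (TableauIn μ n) := Fintype.ofFinite _

/-- The factorial Schur function `s_μ(x_1, …, x_n | a)`, the sum over semistandard tableaux `T`
of shape `μ` with entries in `{1, …, n}` of `∏ (x_{T_ij} + a_{T_ij + j - i})` over the boxes.
The content `j - i` is the same for boxes counted from `0` and from `1`; columns increase
strictly, so `i < T_ij` in the indexing used here and the subtraction never truncates. -/
noncomputable def factorialSchur {R : Type*} [CommRing R] (μ : YoungDiagram) (n : ℕ)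
    (x a : ℕ → R) : R :=
  ∑ T : TableauIn μ n, ∏ c ∈ μ.cells, (x (T.1 c.1 c.2) + a (T.1 c.1 c.2 + c.2 - c.1))

/-- Gelfand-Tsetlin patterns of size `n`: triangular arrays `m i j`, `1 ≤ j ≤ i ≤ n`, of natural
numbers that satisfy the betweenness conditions. As a normalisation, `m i j = 0` for all
indices outside the triangle. -/
@[ext]
structure GTPattern (n : ℕ) where
  m : ℕ → ℕ → ℕ
  upper : ∀ i j, 2 ≤ i → i ≤ n → 1 ≤ j → j ≤ i - 1 → m (i - 1) j ≤ m i j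
  lower : ∀ i j, 2 ≤ i → i ≤ n → 1 ≤ j → j ≤ i - 1 → m i (j + 1) ≤ m (i - 1) j
  zeros : ∀ i j, ¬ (1 ≤ j ∧ j ≤ i ∧ i ≤ n) → m i j = 0

/-- A pattern is strict if each of its rows is strictly decreasing. -/
def GTPattern.IsStrict {n : ℕ} (G : GTPattern n) : Prop :=
  ∀ i j, 1 ≤ i → i ≤ n → 1 ≤ j → j ≤ i - 1 → G.m i (j + 1) < G.m i j

/-- Strict Gelfand-Tsetlin patterns of size `n` with top row `lam 1, …, lam n`. -/
abbrev StrictGT (n : ℕ) (lam : ℕ → ℕ) : Type :=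
  {G : GTPattern n // G.IsStrict ∧ ∀ j, 1 ≤ j → j ≤ n → G.m n j = lam j}

theorem StrictGT.le_sum {n : ℕ} {lam : ℕ → ℕ} (G : StrictGT n lam) (i j : ℕ) :
    G.1.m i j ≤ ∑ k ∈ Finset.Icc 1 n, lam k := by
  by_cases h : 1 ≤ j ∧ j ≤ i ∧ i ≤ n
  · have key : ∀ d i, i + d = n → j ≤ i → G.1.m i j ≤ lam j := by
      intro d
      induction d with
      | zero =>
        intro i hi hj
        obtain rfl : i = n := by omega
        exact le_of_eq (G.2.2 j h.1 hj)
      | succ d ih =>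
        intro i hi hj
        refine le_trans ?_ (ih (i + 1) (by omega) (by omega))
        simpa using G.1.upper (i + 1) j (by omega) (by omega) h.1 (by omega)
    refine le_trans (key (n - i) i (by omega) h.2.1) ?_
    exact Finset.single_le_sum (f := lam) (fun _ _ => Nat.zero_le _)
      (Finset.mem_Icc.2 ⟨h.1, by omega⟩)
  · rw [G.1.zeros i j h]
    exact Nat.zero_le _

instance StrictGT.instFinite (n : ℕ) (lam : ℕ → ℕ) : Finite (StrictGT n lam) := by
  let f : StrictGT n lam →
      (Fin (n + 1) → Fin (n + 1) → Fin (∑ k ∈ Finset.Icc 1 n, lam k + 1)) := fun G i j =>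
    ⟨G.1.m i j, Nat.lt_succ_of_le (G.le_sum i j)⟩
  refine Finite.of_injective f ?_
  intro G H h
  apply Subtype.ext
  apply GTPattern.ext
  funext i j
  by_cases hc : 1 ≤ j ∧ j ≤ i ∧ i ≤ n
  · have h1 := congrFun (congrFun h ⟨i, by omega⟩) ⟨j, by omega⟩
    exact congrArg Fin.val h1
  · rw [G.1.zeros i j hc, H.1.zeros i j hc]

noncomputable instance StrictGT.instFintype (n : ℕ) (lam : ℕ → ℕ) : Fintype (StrictGT n lam) :=
  Fintype.ofFinite _

namespace GTPattern

variable {n : ℕ} (G : GTPattern n) (i j : ℕ)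

/-- Case (L): left-saturated. -/
def CaseL : Prop := G.m i j = G.m (i - 1) j ∧ G.m (i - 1) j > G.m i (j + 1)

/-- Case (R): right-saturated. -/
def CaseR : Prop := G.m i j > G.m (i - 1) j ∧ G.m (i - 1) j = G.m i (j + 1)

/-- Case (B): special, strict on both sides. -/
def CaseB : Prop := G.m i j > G.m (i - 1) j ∧ G.m (i - 1) j > G.m i (j + 1)

end GTPattern

open Classical in
/-- The truth function `χ`. -/
noncomputable def truthValue (R : Type*) [CommRing R] (P : Prop) : R := if P then 1 else 0

/-- The weight of a Gelfand-Tsetlin pattern. -/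
noncomputable def GTPattern.weight {R : Type*} [CommRing R] {n : ℕ} (G : GTPattern n)
    (x y a : ℕ → R) : R :=
  (∏ i ∈ Finset.Icc 1 n, ∏ k ∈ Finset.range (G.m i i), (x i + a k)) *
    ∏ i ∈ Finset.Icc 2 n, ∏ j ∈ Finset.Icc 1 (i - 1),
      ((truthValue R (G.CaseL i j) + truthValue R (G.CaseB i j) * (x i + y i) +
          truthValue R (G.CaseR i j) * (y i - a (G.m (i - 1) j))) *
        ∏ k ∈ Finset.Ioo (G.m (i - 1) j) (G.m i j), (x i + a k))

/-! Write `(z|a)^m = (z + a 0) ⋯ (z + a (m - 1))`. Multiplied by the Vandermonde product `∏ (x i - x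
j)`, both sides become `∏ (x i + y j)` times the alternant `det ((x_j|a)^{lam_i})`.

The link is a branching rule for alternants (`alternant_succ`): row operations and a telescoping sum
remove `x (n + 1)` and leave a determinant whose rows are sums of factorial powers over half-open
intervals between consecutive parts. For patterns, removal of the top row gives sums over closed
intervals with the weights L, B, R. By `sum_entryWeight` such a sum is the half-open one times `x j
+ y (n + 1)`; these factors leave the determinant columnwise, and induction on `n` gives
`pairProd_mul_patternSum`.

For tableaux, removal of the entries `n + 1` matches the same rule after a shift by the staircase,
which gives the bialternant formula `pairProd_mul_schurSeq`. The Vandermonde product may be a zero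
divisor in `R`, so it is cancelled for independent indeterminates over `ℤ`, and the identity is then
specialised. -/

/-! ### Factorial powers and the branching rule for alternants -/

/-- The factorial power `(z + a 0) ⋯ (z + a (m - 1))`. -/
def factorialPow {R : Type*} [CommRing R] (a : ℕ → R) (m : ℕ) (z : R) : R :=
  ∏ k ∈ Finset.range m, (z + a k)

/-- The alternant `det ((x_j | a)^{L_i})`, with rows and columns indexed by `1, …, n`. -/
def alternant {R : Type*} [CommRing R] (a x : ℕ → R) (n : ℕ) (L : ℕ → ℕ) : R :=
  (Matrix.of fun i j : Fin n => factorialPow a (L (i + 1)) (x (j + 1))).det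

/-- The product of `f i j` over the pairs `1 ≤ i < j ≤ n`. -/
def pairProd {R : Type*} [CommRing R] (n : ℕ) (f : ℕ → ℕ → R) : R :=
  ∏ i ∈ Finset.Icc 1 n, ∏ j ∈ Finset.Ioc i n, f i j

section

variable {R : Type*} [CommRing R]

theorem factorialPow_succ (a : ℕ → R) (m : ℕ) (z : R) :
    factorialPow a (m + 1) z = factorialPow a m z * (z + a m) :=
  Finset.prod_range_succ _ _

theorem factorialPow_mul_prod_Ico (a : ℕ → R) {l m : ℕ} (h : l ≤ m) (z : R) :
    factorialPow a l z * ∏ k ∈ Finset.Ico l m, (z + a k) = factorialPow a m z :=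
  Finset.prod_range_mul_prod_Ico _ h

theorem pairProd_succ (n : ℕ) (f : ℕ → ℕ → R) :
    pairProd (n + 1) f = pairProd n f * ∏ i : Fin n, f (i + 1) (n + 1) := by
  unfold pairProd
  rw [Finset.prod_Icc_succ_top (by omega), Finset.Ioc_self, Finset.prod_empty, mul_one,
    Finset.prod_congr rfl (fun i hi => Finset.prod_Ioc_succ_top (Finset.mem_Icc.1 hi).2 (f i)),
    Finset.prod_mul_distrib]
  congr 1
  rw [Fin.prod_univ_eq_prod_range (fun i => f (i + 1) (n + 1)) n, Finset.range_eq_Ico,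
    Finset.prod_Ico_add' (fun i => f i (n + 1)) 0 n 1]
  rfl

theorem det_sum_mul {n : ℕ} (s : Fin n → Finset ℕ) (g : Fin n → ℕ → R) (p : Fin n → ℕ → Fin n → R) :
    (Matrix.of fun i j => ∑ k ∈ s i, g i k * p i k j).det =
      ∑ κ ∈ Fintype.piFinset s,
        (∏ i, g i (κ i)) * (Matrix.of fun i j => p i (κ i) j).det := by
  have h := (Matrix.detRowAlternating (R := R) (n := Fin n)).toMultilinearMap.map_sum_finset
    (fun i k => g i k • p i k) s
  have e : (Matrix.of fun i j => ∑ k ∈ s i, g i k * p i k j) =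
      fun i => ∑ k ∈ s i, g i k • p i k := by
    ext i j
    simp [Finset.sum_apply]
  rw [e]
  refine h.trans (Finset.sum_congr rfl fun κ _ => ?_)
  exact (Matrix.detRowAlternating (R := R) (n := Fin n)).toMultilinearMap.map_smul_univ _ _

/-- Telescoping: since `x - z = (x + a k) - (z + a k)`, the summand at `k` is the difference of the
values at `k + 1` and `k` of `(x|a)^k ∏_{k ≤ q < m} (z + a q)`. -/
theorem sub_mul_sum_factorialPow (a : ℕ → R) (x z : R) {l m : ℕ} (h : l ≤ m) :
    (x - z) * ∑ k ∈ Finset.Ico l m,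
        (∏ q ∈ Finset.Ioo k m, (z + a q)) * factorialPow a k x =
      factorialPow a m x - (∏ q ∈ Finset.Ico l m, (z + a q)) * factorialPow a l x := by
  induction m, h using Nat.le_induction with
  | base => simp
  | succ m h ih =>
    have e : ∑ k ∈ Finset.Ico l m,
        (∏ q ∈ Finset.Ioo k (m + 1), (z + a q)) * factorialPow a k x =
        (∑ k ∈ Finset.Ico l m,
          (∏ q ∈ Finset.Ioo k m, (z + a q)) * factorialPow a k x) * (z + a m) := by
      rw [Finset.sum_mul]
      refine Finset.sum_congr rfl fun k hk => ?_
      have hk := (Finset.mem_Ico.1 hk).2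
      have : Finset.Ioo k (m + 1) = insert m (Finset.Ioo k m) := by ext; simp; omega
      rw [this, Finset.prod_insert (by simp)]
      ring
    have e' : Finset.Ioo m (m + 1) = ∅ := by ext; simp
    rw [Finset.sum_Ico_succ_top h, e, Finset.prod_Ico_succ_top h, factorialPow_succ, e',
      Finset.prod_empty]
    linear_combination (z + a m) * ih

/-- Branching rule for alternants, with the Vandermonde factors cleared. -/
theorem alternant_succ (a x : ℕ → R) (n : ℕ) {L : ℕ → ℕ}
    (hL : ∀ i : Fin n, L (i + 2) ≤ L (i + 1)) :
    alternant a x (n + 1) L =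
      factorialPow a (L (n + 1)) (x (n + 1)) * (∏ i : Fin n, (x (i + 1) - x (n + 1))) *
        (Matrix.of fun i j : Fin n => ∑ k ∈ Finset.Ico (L (i + 2)) (L (i + 1)),
          (∏ q ∈ Finset.Ioo k (L (i + 1)), (x (n + 1) + a q)) *
            factorialPow a k (x (j + 1))).det := by
  set z := x (n + 1) with hz
  set M : Matrix (Fin (n + 1)) (Fin (n + 1)) R :=
    Matrix.of fun i j => factorialPow a (L (i + 1)) (x (j + 1)) with hM
  -- `Q i` is the ratio of the last-column entries of rows `i` and `i + 1`; subtracting `Q i` times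
  -- the next row therefore clears the last column above its bottom entry.
  let Q : Fin n → R := fun i => ∏ q ∈ Finset.Ico (L (i + 2)) (L (i + 1)), (z + a q)
  let N : Matrix (Fin (n + 1)) (Fin (n + 1)) R := Matrix.of fun i =>
    Fin.lastCases (M (Fin.last n)) (fun i j => M i.castSucc j - Q i * M i.succ j) i
  have hdet : M.det = N.det := by
    -- The library lemma adds multiples of the preceding row, whereas the next row is used here;
    -- hence the reversal.
    rw [← Matrix.det_submatrix_equiv_self Fin.revPerm M,
      ← Matrix.det_submatrix_equiv_self Fin.revPerm N]
    refine Matrix.det_eq_of_forall_row_eq_smul_add_pred (fun i => Q i.rev) ?_ ?_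
    · intro j
      simp [N, Fin.rev_zero]
    · intro i j
      simp [N, Fin.rev_succ, Fin.rev_castSucc]
  have hNlast : ∀ i : Fin n, N i.castSucc (Fin.last n) = 0 := by
    intro i
    have := factorialPow_mul_prod_Ico a (hL i) z
    simp only [N, hM, Q, Matrix.of_apply, Fin.lastCases_castSucc, Fin.val_castSucc,
      Fin.val_last, Fin.val_succ, ← hz, add_assoc, one_add_one_eq_two]
    rw [← this]
    ring
  -- By telescoping, column `j` of the remaining minor is divisible by `x (j + 1) - z`.
  have hNsub : N.submatrix (Fin.last n).succAbove (Fin.last n).succAbove =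
      Matrix.of fun i j : Fin n => (x (j + 1) - z) *
        (Matrix.of fun i j : Fin n => ∑ k ∈ Finset.Ico (L (i + 2)) (L (i + 1)),
          (∏ q ∈ Finset.Ioo k (L (i + 1)), (z + a q)) * factorialPow a k (x (j + 1))) i j := by
    ext i j
    simp only [Matrix.submatrix_apply, Fin.succAbove_last, N, hM, Q, Matrix.of_apply,
      Fin.lastCases_castSucc, Fin.val_castSucc, Fin.val_succ, add_assoc, one_add_one_eq_two]
    rw [sub_mul_sum_factorialPow a _ z (hL i)]
  have hNll : N (Fin.last n) (Fin.last n) = factorialPow a (L (n + 1)) z := by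
    simp [N, hM, hz]
  change M.det = _
  rw [hdet, Matrix.det_succ_column N (Fin.last n), Fin.sum_univ_castSucc]
  simp only [hNlast, mul_zero, zero_mul, Finset.sum_const_zero, zero_add, hNll, hNsub,
    Matrix.det_mul_row]
  rw [Even.neg_one_pow ⟨_, rfl⟩]
  ring

/-! ### Weights of single entries -/

/-- The contribution of an entry `k`, lying below `m` and `l`, to the weight of a pattern. -/
noncomputable def entryWeight (a : ℕ → R) (z w : R) (m l k : ℕ) : R :=
  (truthValue R (m = k ∧ k > l) + truthValue R (m > k ∧ k > l) * (z + w) +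
    truthValue R (m > k ∧ k = l) * (w - a k)) * ∏ q ∈ Finset.Ioo k m, (z + a q)

/-- The split `z + w = (w - a k) + (z + a k)` makes case B the sum of an R-type and an L-type term;
the factor `z + a k` extends the product from `Ioo` to `Ico`. -/
theorem entryWeight_eq (a : ℕ → R) (z w : R) {m l k : ℕ} (hl : l ≤ k) (hm : k ≤ m) :
    entryWeight a z w m l k =
      (if k < m then (w - a k) * ∏ q ∈ Finset.Ioo k m, (z + a q) else 0) +
        if l < k then ∏ q ∈ Finset.Ico k m, (z + a q) else 0 := by
  unfold entryWeight truthValue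
  rcases hl.eq_or_lt with rfl | hl
  · rcases hm.eq_or_lt with rfl | hm
    · simp
    · simp [hm, hm.ne']
  · rcases hm.eq_or_lt with rfl | hm
    · simp [hl]
    · have : Finset.Ico k m = insert k (Finset.Ioo k m) := (Finset.Ioo_insert_left hm).symm
      rw [this, Finset.prod_insert (by simp)]
      simp [hl, hm, hm.ne', hl.ne']
      ring

/-- After the L-type sum is shifted by one, both parts share the factor `(∏_{k < q < m} (z + a q))
(x|a)^k`, with coefficients `w - a k` and `x + a k`. Their sum `x + w` does not depend on `k`. -/
theorem sum_entryWeight (a : ℕ → R) (x z w : R) {l m : ℕ} (h : l ≤ m) :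
    ∑ k ∈ Finset.Icc l m, entryWeight a z w m l k * factorialPow a k x =
      (x + w) * ∑ k ∈ Finset.Ico l m,
        (∏ q ∈ Finset.Ioo k m, (z + a q)) * factorialPow a k x := by
  have e : Finset.Icc l m = Finset.Ico l (m + 1) := rfl
  -- The R-type sum has no term at `k = m` and the L-type sum none at `k = l`, so after the shift
  -- both run over `Ico l m`.
  rw [Finset.sum_congr rfl fun k hk => by
    rw [entryWeight_eq a z w (Finset.mem_Icc.1 hk).1 (Finset.mem_Icc.1 hk).2, add_mul],
    Finset.sum_add_distrib, e, Finset.sum_Ico_succ_top h,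
    Finset.sum_eq_sum_Ico_succ_bot (Nat.lt_succ_of_le h) (fun k => (if l < k then _ else _) * _),
    ← Finset.sum_Ico_add' _ l m 1, Finset.mul_sum]
  simp only [lt_irrefl, if_false, zero_mul, add_zero, zero_add]
  rw [← Finset.sum_add_distrib]
  refine Finset.sum_congr rfl fun k hk => ?_
  have hk := Finset.mem_Ico.1 hk
  have e' : Finset.Ico (k + 1) m = Finset.Ioo k m := by ext; simp
  rw [if_pos hk.2, if_pos (by omega), e', factorialPow_succ]
  ring

end

/-! ### Interlacing sequences and removal of the top row of a pattern -/

/-- The sequence with the parts `κ`, indexed by `1, …, n`, and zeros elsewhere. -/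
def seqOf {n : ℕ} (κ : Fin n → ℕ) (i : ℕ) : ℕ :=
  if h : 1 ≤ i ∧ i ≤ n then κ ⟨i - 1, by omega⟩ else 0

theorem seqOf_succ {n : ℕ} (κ : Fin n → ℕ) (i : Fin n) : seqOf κ (i + 1) = κ i := by
  have := i.2
  simp [seqOf]

theorem antitoneOn_Icc_of_succ_le {n : ℕ} {f : ℕ → ℕ}
    (h : ∀ i, 1 ≤ i → i + 1 ≤ n → f (i + 1) ≤ f i) : AntitoneOn f (Set.Icc 1 n) := by
  have key : ∀ d i, 1 ≤ i → i + d ≤ n → f (i + d) ≤ f i := by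
    intro d
    induction d with
    | zero => intro i _ _; exact le_rfl
    | succ d ih =>
      intro i h1 h2
      exact (h (i + d) (by omega) (by omega)).trans (ih i h1 (by omega))
  intro i hi j hj hij
  have := key (j - i) i hi.1 (by have := hj.2; omega)
  rwa [Nat.add_sub_cancel' hij] at this

/-- Sequences that interlace with `L 1, …, L (n + 1)`. -/
def interlacing (n : ℕ) (L : ℕ → ℕ) : Finset (Fin n → ℕ) :=
  Fintype.piFinset fun i => Finset.Icc (L (i + 2)) (L (i + 1))

theorem mem_interlacing {n : ℕ} {L : ℕ → ℕ} {κ : Fin n → ℕ} :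
    κ ∈ interlacing n L ↔
      ∀ i, 1 ≤ i → i ≤ n → L (i + 1) ≤ seqOf κ i ∧ seqOf κ i ≤ L i := by
  simp only [interlacing, Fintype.mem_piFinset, Finset.mem_Icc]
  constructor
  · intro h i h1 h2
    obtain ⟨i, rfl⟩ := Nat.exists_eq_add_of_le' h1
    have := seqOf_succ κ ⟨i, h2⟩
    rw [this]
    exact h ⟨i, h2⟩
  · intro h i
    have := h (i + 1) (by omega) (by omega)
    rwa [seqOf_succ] at this

theorem antitoneOn_seqOf {n : ℕ} {L : ℕ → ℕ} {κ : Fin n → ℕ} (h : κ ∈ interlacing n L) :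
    AntitoneOn (seqOf κ) (Set.Icc 1 n) :=
  antitoneOn_Icc_of_succ_le fun i h1 h2 =>
    (mem_interlacing.1 h (i + 1) (by omega) h2).2.trans
      (mem_interlacing.1 h i h1 (by omega)).1

namespace GTPattern

/-- Removal of the top row. -/
def restrict {n : ℕ} (G : GTPattern (n + 1)) : GTPattern n where
  m i j := if i ≤ n then G.m i j else 0
  upper i j h1 h2 h3 h4 := by
    rw [if_pos h2, if_pos (by omega)]
    exact G.upper i j h1 (by omega) h3 h4
  lower i j h1 h2 h3 h4 := by
    rw [if_pos h2, if_pos (by omega)]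
    exact G.lower i j h1 (by omega) h3 h4
  zeros i j h := by
    split_ifs
    · exact G.zeros i j (by omega)
    · rfl

/-- Addition of a top row. -/
def extend {n : ℕ} (G : GTPattern n) (L : ℕ → ℕ)
    (hL : ∀ j, 1 ≤ j → j ≤ n → L (j + 1) ≤ G.m n j ∧ G.m n j ≤ L j) : GTPattern (n + 1) where
  m i j := if i ≤ n then G.m i j else if i = n + 1 ∧ 1 ≤ j ∧ j ≤ n + 1 then L j else 0
  upper i j h1 h2 h3 h4 := by
    rcases Nat.lt_or_ge n i with h | h
    · obtain rfl : i = n + 1 := by omega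
      simpa [h3, show j ≤ n + 1 by omega] using (hL j h3 (by omega)).2
    · rw [if_pos h, if_pos (by omega)]
      exact G.upper i j h1 h h3 h4
  lower i j h1 h2 h3 h4 := by
    rcases Nat.lt_or_ge n i with h | h
    · obtain rfl : i = n + 1 := by omega
      simpa [h3, show j ≤ n by omega] using (hL j h3 (by omega)).1
    · rw [if_pos h, if_pos (by omega)]
      exact G.lower i j h1 h h3 h4
  zeros i j h := by
    split_ifs with h1 h2
    · exact G.zeros i j (by omega)
    · omega
    · rfl

theorem weight_succ {R : Type*} [CommRing R] {n : ℕ} (G : GTPattern (n + 1)) (x y a : ℕ → R) :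
    G.weight x y a =
      (factorialPow a (G.m (n + 1) (n + 1)) (x (n + 1)) *
        ∏ j : Fin n, entryWeight a (x (n + 1)) (y (n + 1)) (G.m (n + 1) (j + 1))
          (G.m (n + 1) (j + 2)) (G.m n (j + 1))) * G.restrict.weight x y a := by
  have hrow : ∏ j : Fin n, entryWeight a (x (n + 1)) (y (n + 1)) (G.m (n + 1) (j + 1))
      (G.m (n + 1) (j + 2)) (G.m n (j + 1)) = ∏ j ∈ Finset.Icc 1 n,
        entryWeight a (x (n + 1)) (y (n + 1)) (G.m (n + 1) j) (G.m (n + 1) (j + 1))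
          (G.m n j) := by
    rw [Fin.prod_univ_eq_prod_range (fun j => entryWeight a (x (n + 1)) (y (n + 1))
      (G.m (n + 1) (j + 1)) (G.m (n + 1) (j + 2)) (G.m n (j + 1))) n, Finset.range_eq_Ico,
      Finset.prod_Ico_add' (fun j => entryWeight a (x (n + 1)) (y (n + 1))
      (G.m (n + 1) j) (G.m (n + 1) (j + 1)) (G.m n j)) 0 n 1]
    rfl
  have h1 : ∏ i ∈ Finset.Icc 1 n, ∏ k ∈ Finset.range (G.restrict.m i i), (x i + a k) =
      ∏ i ∈ Finset.Icc 1 n, ∏ k ∈ Finset.range (G.m i i), (x i + a k) :=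
    Finset.prod_congr rfl fun i hi => by simp [restrict, (Finset.mem_Icc.1 hi).2]
  -- Stated for arbitrary `f`, so that the truth values of the three cases need not be unfolded.
  have h2 : ∀ f : ℕ → ℕ → ℕ → ℕ → ℕ → R,
      ∏ i ∈ Finset.Icc 2 (n + 1), ∏ j ∈ Finset.Icc 1 (i - 1),
        f i j (G.m i j) (G.m (i - 1) j) (G.m i (j + 1)) =
      (∏ i ∈ Finset.Icc 2 n, ∏ j ∈ Finset.Icc 1 (i - 1),
        f i j (G.restrict.m i j) (G.restrict.m (i - 1) j) (G.restrict.m i (j + 1))) *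
      ∏ j ∈ Finset.Icc 1 n,
        f (n + 1) j (G.m (n + 1) j) (G.m n j) (G.m (n + 1) (j + 1)) := by
    intro f
    rcases n.eq_zero_or_pos with rfl | hn
    · simp
    · rw [Finset.prod_Icc_succ_top (by omega)]
      congr 1
      refine Finset.prod_congr rfl fun i hi => Finset.prod_congr rfl fun j hj => ?_
      have := (Finset.mem_Icc.1 hi).2
      simp [restrict, this, show i ≤ n + 1 by omega]
  rw [hrow]
  unfold weight CaseL CaseB CaseR
  rw [Finset.prod_Icc_succ_top (by omega), h1,
    h2 fun i _ p k q => (truthValue R (p = k ∧ k > q) + truthValue R (p > k ∧ k > q) *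
      (x i + y i) + truthValue R (p > k ∧ k = q) * (y i - a k)) * ∏ k ∈ Finset.Ioo k p, (x i + a k)]
  unfold entryWeight factorialPow
  ring

end GTPattern

/-! ### The deformed Weyl denominator formula -/

section

variable {R : Type*} [CommRing R]

/-- The total weight of the strict patterns with top row `L`. -/
noncomputable def patternSum (x y a : ℕ → R) (n : ℕ) (L : ℕ → ℕ) : R :=
  ∑ G : StrictGT n L, G.1.weight x y a

/-- Patterns are grouped by their second row `κ`. Sequences `κ` that are not strict may be kept,
because no strict pattern has such a row; the index set is then a full product of intervals, as the
expansion of a determinant requires. -/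
theorem patternSum_succ (x y a : ℕ → R) (n : ℕ) {L : ℕ → ℕ}
    (hL : StrictAntiOn L (Set.Icc 1 (n + 1))) :
    patternSum x y a (n + 1) L = ∑ κ ∈ interlacing n L,
      (factorialPow a (L (n + 1)) (x (n + 1)) *
        ∏ j : Fin n, entryWeight a (x (n + 1)) (y (n + 1)) (L (j + 1)) (L (j + 2)) (κ j)) *
      patternSum x y a n (seqOf κ) := by
  classical
  let row : StrictGT (n + 1) L → Fin n → ℕ := fun G j => G.1.m n (j + 1)
  have hseq : ∀ G : StrictGT (n + 1) L, ∀ j, 1 ≤ j → j ≤ n → seqOf (row G) j = G.1.m n j := by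
    intro G j h1 h2
    simp [seqOf, row, h1, h2]
  have hmaps : ∀ G ∈ (Finset.univ : Finset (StrictGT (n + 1) L)), row G ∈ interlacing n L := by
    intro G _
    refine mem_interlacing.2 fun j h1 h2 => ?_
    rw [hseq G j h1 h2, ← G.2.2 j h1 (by omega), ← G.2.2 (j + 1) (by omega) (by omega)]
    exact ⟨G.1.lower (n + 1) j (by omega) le_rfl h1 (by omega),
      G.1.upper (n + 1) j (by omega) le_rfl h1 (by omega)⟩
  unfold patternSum
  rw [← Finset.sum_fiberwise_of_maps_to hmaps]
  refine Finset.sum_congr rfl fun κ hκ => ?_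
  have hκ' := mem_interlacing.1 hκ
  rw [Finset.mul_sum]
  refine Finset.sum_bij'
    (fun G hG => (⟨G.1.restrict, ?_, ?_⟩ : StrictGT n (seqOf κ)))
    (fun H _ => (⟨H.1.extend L ?_, ?_, ?_⟩ : StrictGT (n + 1) L)) ?_ ?_ ?_ ?_ ?_
  · intro i j h1 h2 h3 h4
    simpa [GTPattern.restrict, h2] using G.2.1 i j h1 (by omega) h3 h4
  · intro j h1 h2
    rw [← (Finset.mem_filter.1 hG).2, hseq G j h1 h2]
    simp [GTPattern.restrict]
  · intro j h1 h2
    rw [H.2.2 j h1 h2]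
    exact hκ' j h1 h2
  · intro i j h1 h2 h3 h4
    rcases Nat.lt_or_ge n i with h | h
    · obtain rfl : i = n + 1 := by omega
      have := hL ⟨h3, by omega⟩ ⟨by omega, by omega⟩ (Nat.lt_succ_self j)
      simpa [GTPattern.extend, h3, show j ≤ n by omega, show j ≤ n + 1 by omega] using this
    · simpa [GTPattern.extend, h] using H.2.1 i j h1 h h3 h4
  · intro j h1 h2
    simp [GTPattern.extend, h1, h2]
  · intro G hG
    exact Finset.mem_univ _
  · intro H _
    refine Finset.mem_filter.2 ⟨Finset.mem_univ _, ?_⟩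
    funext j
    have := H.2.2 (j + 1) (by omega) (by omega)
    simp [row, GTPattern.extend, this, seqOf_succ]
  · intro G hG
    apply Subtype.ext
    apply GTPattern.ext
    funext i j
    by_cases h : i ≤ n
    · simp [GTPattern.extend, GTPattern.restrict, h]
    · simp only [GTPattern.extend, h, if_false]
      split_ifs with h'
      · obtain ⟨rfl, h1, h2⟩ := h'
        exact (G.2.2 j h1 h2).symm
      · exact (G.1.zeros i j (by omega)).symm
  · intro H _
    apply Subtype.ext
    apply GTPattern.ext
    funext i j
    by_cases h : i ≤ n
    · simp [GTPattern.extend, GTPattern.restrict, h]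
    · simpa [GTPattern.restrict, h] using (H.1.zeros i j (by omega)).symm
  · intro G hG
    rw [GTPattern.weight_succ, G.2.2 (n + 1) (by omega) le_rfl]
    congr 2
    refine Finset.prod_congr rfl fun j _ => ?_
    have h1 := G.2.2 (j + 1) (by omega) (by omega)
    have h2 := G.2.2 (j + 2) (by omega) (by omega)
    rw [h1, h2, ← (Finset.mem_filter.1 hG).2]

theorem patternSum_eq_zero (x y a : ℕ → R) {n : ℕ} {L : ℕ → ℕ}
    (hL : ¬ StrictAntiOn L (Set.Icc 1 n)) : patternSum x y a n L = 0 := by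
  have : IsEmpty (StrictGT n L) := by
    refine ⟨fun G => hL (strictAntiOn_of_succ_lt Set.ordConnected_Icc fun j _ hj hj' => ?_)⟩
    simp only [Order.succ_eq_add_one, Set.mem_Icc] at hj hj' ⊢
    rw [← G.2.2 j hj.1 hj.2, ← G.2.2 (j + 1) hj'.1 hj'.2]
    exact G.2.1 n j (by omega) le_rfl hj.1 (by omega)
  simp [patternSum]

/-- Two equal parts give two equal rows. Thus the terms for non-strict `κ` vanish on the alternant
side as well. -/
theorem alternant_eq_zero (a x : ℕ → R) {n : ℕ} {L : ℕ → ℕ} (hanti : AntitoneOn L (Set.Icc 1 n))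
    (hL : ¬ StrictAntiOn L (Set.Icc 1 n)) : alternant a x n L = 0 := by
  have h : ∃ i ∈ Set.Icc 1 n, ∃ j ∈ Set.Icc 1 n, i < j ∧ L i = L j := by
    by_contra! hne
    exact hL fun i hi j hj hij => lt_of_le_of_ne (hanti hi hj hij.le) (hne i hi j hj hij).symm
  obtain ⟨i, hi, j, hj, hij, h⟩ := h
  obtain ⟨h1, h2⟩ := hi
  obtain ⟨h3, h4⟩ := hj
  refine Matrix.det_zero_of_row_eq (i := ⟨i - 1, by omega⟩) (j := ⟨j - 1, by omega⟩)
    (by simp; omega) ?_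
  funext k
  simp [Nat.sub_add_cancel h1, Nat.sub_add_cancel h3, h]

theorem det_sum_mul_factorialPow (a x : ℕ → R) {n : ℕ} (s : Fin n → Finset ℕ)
    (g : Fin n → ℕ → R) :
    (Matrix.of fun i j : Fin n => ∑ k ∈ s i, g i k * factorialPow a k (x (j + 1))).det =
      ∑ κ ∈ Fintype.piFinset s, (∏ i, g i (κ i)) * alternant a x n (seqOf κ) := by
  rw [det_sum_mul s g fun _ k j => factorialPow a k (x (j + 1))]
  simp only [alternant, seqOf_succ]

/-- The deformed Weyl denominator formula for strict patterns. -/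
theorem pairProd_mul_patternSum (x y a : ℕ → R) (n : ℕ) {L : ℕ → ℕ}
    (hL : AntitoneOn L (Set.Icc 1 n)) :
    pairProd n (fun i j => x i - x j) * patternSum x y a n L =
      pairProd n (fun i j => x i + y j) * alternant a x n L := by
  -- Only weak monotonicity of `L` is assumed, so the induction hypothesis covers every interlacing
  -- `κ`.
  induction n generalizing L with
  | zero =>
    let G₀ : StrictGT 0 L := ⟨⟨fun _ _ => 0, by simp, by simp, by simp⟩,
      fun i j _ _ _ _ => by omega, fun j _ _ => by omega⟩
    have : Subsingleton (StrictGT 0 L) := ⟨fun G H => by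
      apply Subtype.ext
      apply GTPattern.ext
      funext i j
      rw [G.1.zeros i j (by omega), H.1.zeros i j (by omega)]⟩
    rw [patternSum, Fintype.sum_subsingleton _ G₀]
    simp [pairProd, alternant, GTPattern.weight]
  | succ n ih =>
    by_cases hs : StrictAntiOn L (Set.Icc 1 (n + 1))
    · have hle : ∀ i : Fin n, L (i + 2) ≤ L (i + 1) := fun i =>
        hL ⟨by omega, by omega⟩ ⟨by omega, by omega⟩ (by omega)
      have hdet : (Matrix.of fun i j : Fin n => ∑ k ∈ Finset.Icc (L (i + 2)) (L (i + 1)),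
          entryWeight a (x (n + 1)) (y (n + 1)) (L (i + 1)) (L (i + 2)) k *
            factorialPow a k (x (j + 1))).det =
          (∏ j : Fin n, (x (j + 1) + y (n + 1))) *
            (Matrix.of fun i j : Fin n => ∑ k ∈ Finset.Ico (L (i + 2)) (L (i + 1)),
              (∏ q ∈ Finset.Ioo k (L (i + 1)), (x (n + 1) + a q)) *
                factorialPow a k (x (j + 1))).det := by
        rw [← Matrix.det_mul_row]
        congr 1
        ext i j
        exact sum_entryWeight a _ _ _ (hle i)
      -- Multilinearity in the rows turns the left side into the sum over interlacing `κ` that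
      -- occurs in `patternSum_succ`.
      rw [det_sum_mul_factorialPow a x _ fun i k =>
        entryWeight a (x (n + 1)) (y (n + 1)) (L (i + 1)) (L (i + 2)) k] at hdet
      rw [patternSum_succ x y a n hs, pairProd_succ, pairProd_succ, alternant_succ a x n hle]
      have hsum : pairProd n (fun i j => x i - x j) * ∑ κ ∈ interlacing n L,
          (factorialPow a (L (n + 1)) (x (n + 1)) *
            ∏ j : Fin n, entryWeight a (x (n + 1)) (y (n + 1)) (L (j + 1)) (L (j + 2)) (κ j)) *
          patternSum x y a n (seqOf κ) =
          factorialPow a (L (n + 1)) (x (n + 1)) * pairProd n (fun i j => x i + y j) *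
          ∑ κ ∈ interlacing n L, (∏ j : Fin n,
            entryWeight a (x (n + 1)) (y (n + 1)) (L (j + 1)) (L (j + 2)) (κ j)) *
            alternant a x n (seqOf κ) := by
        rw [Finset.mul_sum, Finset.mul_sum]
        refine Finset.sum_congr rfl fun κ hκ => ?_
        linear_combination (factorialPow a (L (n + 1)) (x (n + 1)) *
            ∏ j : Fin n, entryWeight a (x (n + 1)) (y (n + 1)) (L (j + 1)) (L (j + 2)) (κ j)) *
            ih (antitoneOn_seqOf hκ)
      unfold interlacing at hsum ⊢
      rw [hdet] at hsum
      linear_combination (∏ i : Fin n, (x (i + 1) - x (n + 1))) * hsum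
    · rw [patternSum_eq_zero x y a hs, alternant_eq_zero a x hL hs, mul_zero, mul_zero]

end

/-! ### Removal of the largest entry from a tableau -/

theorem Finset.mem_iff_lt_card_of_downward {s : Finset ℕ}
    (h : ∀ i ∈ s, ∀ j, j < i → j ∈ s) (i : ℕ) : i ∈ s ↔ i < s.card := by
  have hsub : s ⊆ Finset.range s.card := by
    intro i hi
    have : Finset.range (i + 1) ⊆ s := by
      intro j hj
      rcases (Nat.lt_succ_iff.1 (Finset.mem_range.1 hj)).eq_or_lt with rfl | hj
      · exact hi
      · exact h i hi j hj
    have := Finset.card_le_card this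
    rw [Finset.card_range] at this
    exact Finset.mem_range.2 this
  rw [← Finset.mem_range, ← Finset.eq_of_subset_of_card_le hsub (by simp)]

theorem prod_diagramOf {M : Type*} [CommMonoid M] {n : ℕ} {μ : ℕ → ℕ}
    (hμ : AntitoneOn μ (Set.Icc 1 n)) (f : ℕ × ℕ → M) :
    ∏ c ∈ (diagramOf n μ hμ).cells, f c =
      ∏ i : Fin n, ∏ j ∈ Finset.range (μ (i + 1)), f (i, j) := by
  rw [Fin.prod_univ_eq_prod_range (fun i => ∏ j ∈ Finset.range (μ (i + 1)), f (i, j)) n,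
    Finset.prod_sigma']
  refine Finset.prod_bij' (fun c _ => ⟨c.1, c.2⟩) (fun c _ => (c.1, c.2)) ?_ ?_ ?_ ?_ ?_
  · rintro ⟨i, j⟩ h
    rw [YoungDiagram.mem_cells, mem_diagramOf] at h
    simpa using h
  · rintro ⟨i, j⟩ h
    rw [YoungDiagram.mem_cells, mem_diagramOf]
    simpa using h
  all_goals intros; rfl

theorem lt_seqOf {n : ℕ} {κ : Fin n → ℕ} {i j : ℕ} (h : j < seqOf κ (i + 1)) : i < n := by
  by_contra hn
  rw [seqOf, dif_neg (by omega)] at h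
  omega

theorem SemistandardYoungTableau.lt_entry {μ : YoungDiagram} (T : SemistandardYoungTableau μ)
    (h : ∀ i j, (i, j) ∈ μ → 1 ≤ T i j) {i j : ℕ} (hc : (i, j) ∈ μ) : i < T i j := by
  induction i with
  | zero => exact h 0 j hc
  | succ i ih =>
    have := ih (μ.up_left_mem (Nat.le_succ i) le_rfl hc)
    have := T.col_strict (Nat.lt_add_one i) hc
    omega

namespace TableauIn

variable {n : ℕ} {μ : ℕ → ℕ} {hμ : AntitoneOn μ (Set.Icc 1 (n + 1))}

/-- The row lengths of the part of a tableau with entries at most `n`. -/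
def innerShape (T : TableauIn (diagramOf (n + 1) μ hμ) (n + 1)) (i : Fin n) : ℕ :=
  ((Finset.range (μ (i + 1))).filter fun j => T.1 i j ≤ n).card

/-- Rows increase weakly, so the entries at most `n` form an initial segment of each row, determined
by its length. -/
theorem lt_innerShape (T : TableauIn (diagramOf (n + 1) μ hμ) (n + 1)) (i j : ℕ) :
    j < seqOf T.innerShape (i + 1) ↔ (i, j) ∈ diagramOf (n + 1) μ hμ ∧ T.1 i j ≤ n := by
  rcases Nat.lt_or_ge i n with h | h
  · rw [show seqOf T.innerShape (i + 1) = _ from seqOf_succ T.innerShape ⟨i, h⟩, innerShape,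
      ← Finset.mem_iff_lt_card_of_downward]
    · simp [mem_diagramOf, show i < n + 1 by omega]
    · intro p hp q hq
      simp only [Finset.mem_filter, Finset.mem_range] at hp ⊢
      exact ⟨hq.trans hp.1, (T.1.row_weak hq ((mem_diagramOf hμ _ _).2
        ⟨by omega, hp.1⟩)).trans hp.2⟩
  · constructor
    · intro h'
      have := lt_seqOf h'
      omega
    -- Strict columns force entries above `i` in row `i`, counted from `0`, so rows from `n` on have
    -- no entry at most `n`.
    · rintro ⟨h1, h2⟩
      have := T.1.lt_entry (fun i j hc => (T.2 i j hc).1) h1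
      omega

/-- The entries `n + 1` form a horizontal strip: a box directly above another one has a strictly
smaller entry, hence at most `n`, and lies in the inner shape. -/
theorem innerShape_mem (T : TableauIn (diagramOf (n + 1) μ hμ) (n + 1)) :
    T.innerShape ∈ interlacing n μ := by
  refine mem_interlacing.2 fun i h1 h2 => ?_
  obtain ⟨i, rfl⟩ := Nat.exists_eq_add_of_le' h1
  constructor
  · by_contra! hlt
    have hc : (i + 1, seqOf T.innerShape (i + 1)) ∈ diagramOf (n + 1) μ hμ :=
      (mem_diagramOf hμ _ _).2 ⟨by omega, hlt⟩
    refine lt_irrefl _ ((T.lt_innerShape i _).2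
      ⟨(diagramOf (n + 1) μ hμ).up_left_mem (Nat.le_succ i) le_rfl hc, ?_⟩)
    have := T.1.col_strict (Nat.lt_add_one i) hc
    have := (T.2 _ _ hc).2
    omega
  · by_contra! hlt
    have := (mem_diagramOf hμ _ _).1 ((T.lt_innerShape i _).1 hlt).1
    omega

theorem innerShape_eq {T : TableauIn (diagramOf (n + 1) μ hμ) (n + 1)} {ν : Fin n → ℕ}
    (h : ∀ i j, j < seqOf ν (i + 1) ↔ (i, j) ∈ diagramOf (n + 1) μ hμ ∧ T.1 i j ≤ n) :
    T.innerShape = ν := by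
  funext i
  rw [← seqOf_succ T.innerShape i, ← seqOf_succ ν i]
  refine eq_of_forall_lt_iff fun j => ?_
  rw [T.lt_innerShape, h]

/-- The part of a tableau inside a diagram all of whose entries are at most `n`. -/
def restrict (T : TableauIn (diagramOf (n + 1) μ hμ) (n + 1)) {ν : Fin n → ℕ}
    (hν : AntitoneOn (seqOf ν) (Set.Icc 1 n)) (h : T.innerShape = ν) :
    TableauIn (diagramOf n (seqOf ν) hν) n :=
  have key : ∀ i j, (i, j) ∈ diagramOf n (seqOf ν) hν →
      j < seqOf ν (i + 1) ∧ (i, j) ∈ diagramOf (n + 1) μ hμ ∧ T.1 i j ≤ n := fun i j hc => by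
    have := ((mem_diagramOf hν i j).1 hc).2
    subst h
    exact ⟨this, (T.lt_innerShape i j).1 this⟩
  ⟨{ entry := fun i j => if j < seqOf ν (i + 1) then T.1 i j else 0
     row_weak' := fun {i j₁ j₂} hj hc => by
      have h2 := key _ _ hc
      rw [if_pos (hj.trans h2.1), if_pos h2.1]
      exact T.1.row_weak hj h2.2.1
     col_strict' := fun {i₁ i₂ j} hi hc => by
      have h1 := key _ _ ((diagramOf n (seqOf ν) hν).up_left_mem hi.le le_rfl hc)
      have h2 := key _ _ hc
      rw [if_pos h1.1, if_pos h2.1]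
      exact T.1.col_strict hi h2.2.1
     zeros' := fun {i j} hc => by
      rw [if_neg fun hj => hc ((mem_diagramOf hν i j).2 ⟨lt_seqOf hj, hj⟩)] },
    fun i j hc => by
      have h1 := key _ _ hc
      change 1 ≤ (if _ then _ else _) ∧ (if _ then _ else _) ≤ n
      rw [if_pos h1.1]
      exact ⟨(T.2 _ _ h1.2.1).1, h1.2.2⟩⟩

/-- The tableau obtained by filling the boxes outside an inner diagram by `n + 1`. -/
def extend {ν : Fin n → ℕ} {hν : AntitoneOn (seqOf ν) (Set.Icc 1 n)}
    (U : TableauIn (diagramOf n (seqOf ν) hν) n) (hμ : AntitoneOn μ (Set.Icc 1 (n + 1)))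
    (h : ν ∈ interlacing n μ) : TableauIn (diagramOf (n + 1) μ hμ) (n + 1) :=
  have h := mem_interlacing.1 h
  have key : ∀ {i j}, j < seqOf ν (i + 1) → (i, j) ∈ diagramOf n (seqOf ν) hν := fun hj =>
    (mem_diagramOf hν _ _).2 ⟨lt_seqOf hj, hj⟩
  ⟨{ entry := fun i j => if j < seqOf ν (i + 1) then U.1 i j else
       if i < n + 1 ∧ j < μ (i + 1) then n + 1 else 0
     row_weak' := fun {i j₁ j₂} hj hc => by
      have hc := (mem_diagramOf hμ _ _).1 hc
      by_cases h2 : j₂ < seqOf ν (i + 1)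
      · rw [if_pos h2, if_pos (hj.trans h2)]
        exact U.1.row_weak hj (key h2)
      · rw [if_neg h2, if_pos hc]
        split_ifs with h1
        · exact (U.2 _ _ (key h1)).2.trans (Nat.le_succ n)
        all_goals omega
     col_strict' := fun {i₁ i₂ j} hi hc => by
      have hc := (mem_diagramOf hμ _ _).1 hc
      -- Interlacing places every box with a box below it inside the inner diagram, so no column
      -- receives `n + 1` twice.
      have h3 : μ (i₂ + 1) ≤ μ (i₁ + 1 + 1) :=
        hμ ⟨by omega, by omega⟩ ⟨by omega, by omega⟩ (by omega)
      have h1 : j < seqOf ν (i₁ + 1) := by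
        have := (h (i₁ + 1) (by omega) (by omega)).1
        omega
      rw [if_pos h1]
      by_cases h2 : j < seqOf ν (i₂ + 1)
      · rw [if_pos h2]
        exact U.1.col_strict hi (key h2)
      · rw [if_neg h2, if_pos hc]
        exact Nat.lt_succ_of_le (U.2 _ _ (key h1)).2
     zeros' := fun {i j} hc => by
      rw [mem_diagramOf] at hc
      rw [if_neg, if_neg hc]
      intro hj
      have := lt_seqOf hj
      have := (h (i + 1) (by omega) (by omega)).2
      omega },
    fun i j hc => by
      have hc := (mem_diagramOf hμ _ _).1 hc
      change 1 ≤ (if _ then _ else _) ∧ (if _ then _ else _) ≤ n + 1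
      by_cases h1 : j < seqOf ν (i + 1)
      · have := U.2 _ _ (key h1)
        rw [if_pos h1]
        omega
      · rw [if_neg h1, if_pos hc]
        omega⟩

theorem restrict_apply (T : TableauIn (diagramOf (n + 1) μ hμ) (n + 1)) {ν : Fin n → ℕ}
    (hν : AntitoneOn (seqOf ν) (Set.Icc 1 n)) (h : T.innerShape = ν) (i j : ℕ) :
    (T.restrict hν h).1 i j = if j < seqOf ν (i + 1) then T.1 i j else 0 := rfl

theorem extend_apply {ν : Fin n → ℕ} {hν : AntitoneOn (seqOf ν) (Set.Icc 1 n)}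
    (U : TableauIn (diagramOf n (seqOf ν) hν) n) (hμ : AntitoneOn μ (Set.Icc 1 (n + 1)))
    (h : ν ∈ interlacing n μ) (i j : ℕ) :
    (U.extend hμ h).1 i j = if j < seqOf ν (i + 1) then U.1 i j else
       if i < n + 1 ∧ j < μ (i + 1) then n + 1 else 0 := rfl

theorem innerShape_extend {ν : Fin n → ℕ} {hν : AntitoneOn (seqOf ν) (Set.Icc 1 n)}
    (U : TableauIn (diagramOf n (seqOf ν) hν) n) (hμ : AntitoneOn μ (Set.Icc 1 (n + 1)))
    (h : ν ∈ interlacing n μ) : (U.extend hμ h).innerShape = ν := by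
  refine innerShape_eq fun i j => ?_
  rw [extend_apply, mem_diagramOf]
  by_cases hj : j < seqOf ν (i + 1)
  · have := lt_seqOf hj
    have := (mem_interlacing.1 h (i + 1) (by omega) (by omega)).2
    have := (U.2 i j ((mem_diagramOf hν _ _).2 ⟨lt_seqOf hj, hj⟩)).2
    rw [if_pos hj]
    omega
  · rw [if_neg hj]
    split_ifs <;> omega

end TableauIn

/-! ### The bialternant formula for factorial Schur functions -/

section

variable {R : Type*} [CommRing R]

open Classical in
/-- The factorial Schur function of the shape `(μ 1, …, μ n)`. -/
noncomputable def schurSeq (x a : ℕ → R) (n : ℕ) (μ : ℕ → ℕ) : R :=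
  if hμ : AntitoneOn μ (Set.Icc 1 n) then factorialSchur (diagramOf n μ hμ) n x a else 0

/-- Tableaux are grouped by the shape `ν` of their entries at most `n`; the boxes outside `ν` all
carry `n + 1`. The last product is the bottom row, which lies wholly outside `ν`. -/
theorem schurSeq_succ (x a : ℕ → R) (n : ℕ) {μ : ℕ → ℕ}
    (hμ : AntitoneOn μ (Set.Icc 1 (n + 1))) :
    schurSeq x a (n + 1) μ = ∑ ν ∈ interlacing n μ,
      ((∏ i : Fin n, ∏ j ∈ Finset.Ico (ν i) (μ (i + 1)), (x (n + 1) + a (n + 1 + j - i))) *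
        ∏ j ∈ Finset.range (μ (n + 1)), (x (n + 1) + a (j + 1))) *
      schurSeq x a n (seqOf ν) := by
  classical
  rw [schurSeq, dif_pos hμ, factorialSchur,
    ← Finset.sum_fiberwise_of_maps_to (g := TableauIn.innerShape) (t := interlacing n μ)
      fun T _ => T.innerShape_mem]
  refine Finset.sum_congr rfl fun ν hν => ?_
  have hanti := antitoneOn_seqOf hν
  have hle := mem_interlacing.1 hν
  rw [schurSeq, dif_pos hanti, factorialSchur, Finset.mul_sum]
  refine Finset.sum_bij' (fun T hT => T.restrict hanti (Finset.mem_filter.1 hT).2)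
    (fun U _ => U.extend hμ hν) ?_ ?_ ?_ ?_ ?_
  · intro T hT
    exact Finset.mem_univ _
  · intro U _
    exact Finset.mem_filter.2 ⟨Finset.mem_univ _, U.innerShape_extend hμ hν⟩
  · intro T hT
    have hT := (Finset.mem_filter.1 hT).2
    apply Subtype.ext
    apply SemistandardYoungTableau.ext
    intro i j
    rw [TableauIn.extend_apply, TableauIn.restrict_apply]
    have h1 := T.lt_innerShape i j
    rw [hT] at h1
    simp only [← mem_diagramOf hμ]
    split_ifs with h2 h3
    · rfl
    · have := (T.2 i j h3).2
      have : ¬ T.1 i j ≤ n := fun h => h2 (h1.2 ⟨h3, h⟩)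
      omega
    · exact (T.1.zeros h3).symm
  · intro U _
    apply Subtype.ext
    apply SemistandardYoungTableau.ext
    intro i j
    rw [TableauIn.restrict_apply, TableauIn.extend_apply]
    split_ifs with h2
    · rfl
    · exact (U.1.zeros fun hc => h2 ((mem_diagramOf hanti _ _).1 hc).2).symm
  · intro T hT
    have hT := (Finset.mem_filter.1 hT).2
    have h1 := T.lt_innerShape
    rw [hT] at h1
    rw [prod_diagramOf, prod_diagramOf, Fin.prod_univ_castSucc]
    simp only [TableauIn.restrict_apply, Fin.val_castSucc, Fin.val_last]
    have hout : ∀ i j, i < n + 1 → j < μ (i + 1) → ¬ j < seqOf ν (i + 1) →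
        T.1 i j = n + 1 := by
      intro i j hi hj hn
      have hc := (mem_diagramOf hμ i j).2 ⟨hi, hj⟩
      have := (T.2 i j hc).2
      have : ¬ T.1 i j ≤ n := fun h => hn ((h1 i j).2 ⟨hc, h⟩)
      omega
    have hlast : ∏ j ∈ Finset.range (μ (n + 1)), (x (T.1 n j) + a (T.1 n j + j - n)) =
        ∏ j ∈ Finset.range (μ (n + 1)), (x (n + 1) + a (j + 1)) := by
      refine Finset.prod_congr rfl fun j hj => ?_
      rw [hout n j (by omega) (Finset.mem_range.1 hj) fun h => by have := lt_seqOf h; omega,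
        show n + 1 + j - n = j + 1 by omega]
    have hrows : ∏ i : Fin n, ∏ j ∈ Finset.range (μ (i + 1)),
        (x (T.1 i j) + a (T.1 i j + j - i)) =
        (∏ i : Fin n, ∏ j ∈ Finset.Ico (ν i) (μ (i + 1)),
          (x (n + 1) + a (n + 1 + j - i))) *
        ∏ i : Fin n, ∏ j ∈ Finset.range (seqOf ν (i + 1)),
          (x (if j < seqOf ν (i + 1) then T.1 i j else 0) +
            a ((if j < seqOf ν (i + 1) then T.1 i j else 0) + j - i)) := by
      rw [← Finset.prod_mul_distrib]
      refine Finset.prod_congr rfl fun i _ => ?_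
      have hi := hle (i + 1) (by omega) (by omega)
      rw [← Finset.prod_range_mul_prod_Ico _ hi.2, mul_comm, ← seqOf_succ ν i]
      congr 1
      · refine Finset.prod_congr rfl fun j hj => ?_
        have hj := Finset.mem_Ico.1 hj
        rw [hout i j (by omega) hj.2 (by omega)]
      · refine Finset.prod_congr rfl fun j hj => ?_
        rw [if_pos (Finset.mem_range.1 hj)]
    rw [hlast, hrows]
    ring

/-- The bialternant formula for factorial Schur functions. -/
theorem pairProd_mul_schurSeq (x a : ℕ → R) (ha : a 0 = 0) (n : ℕ) {μ : ℕ → ℕ}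
    (hμ : AntitoneOn μ (Set.Icc 1 n)) :
    pairProd n (fun i j => x i - x j) * (∏ i ∈ Finset.Icc 1 n, x i) * schurSeq x a n μ =
      alternant a x n fun i => μ i + staircase n i := by
  induction n generalizing μ with
  | zero =>
    have : Subsingleton (TableauIn (diagramOf 0 μ hμ) 0) := ⟨fun T U => by
      apply Subtype.ext
      apply SemistandardYoungTableau.ext
      intro i j
      have h : (i, j) ∉ diagramOf 0 μ hμ := by simp [mem_diagramOf]
      rw [T.1.zeros h, U.1.zeros h]⟩
    let T₀ : TableauIn (diagramOf 0 μ hμ) 0 :=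
      ⟨⟨fun _ _ => 0, fun _ _ => le_rfl, fun _ h => by simp [mem_diagramOf] at h,
        fun _ => rfl⟩, fun i j h => by simp [mem_diagramOf] at h⟩
    rw [schurSeq, dif_pos hμ, factorialSchur, Fintype.sum_subsingleton _ T₀, prod_diagramOf]
    simp [pairProd, alternant]
  | succ n ih =>
    have hle : ∀ i : Fin n, μ (i + 2) ≤ μ (i + 1) := fun i =>
      hμ ⟨by omega, by omega⟩ ⟨by omega, by omega⟩ (by omega)
    have hstair : ∀ i : Fin n, staircase (n + 1) (i + 1) = n - i + 1 ∧
        staircase (n + 1) (i + 2) = n - i ∧ staircase n (i + 1) = n - i := by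
      intro i
      unfold staircase
      omega
    rw [schurSeq_succ x a n hμ, alternant_succ a x n fun i => by
      have := hle i
      have := hstair i
      omega]
    -- The substitution `k ↦ k + (n - i)` turns the half-open interval between parts of `μ + δ` into
    -- the closed interval between parts of `μ`, because consecutive staircase parts differ by one.
    -- Shifting `q` by `n - i + 1` produces the indices `n + 1 + q - i` of the tableau weight.
    have hdet : (Matrix.of fun i j : Fin n =>
        ∑ k ∈ Finset.Ico (μ (i + 2) + staircase (n + 1) (i + 2))
          (μ (i + 1) + staircase (n + 1) (i + 1)),
          (∏ q ∈ Finset.Ioo k (μ (i + 1) + staircase (n + 1) (i + 1)), (x (n + 1) + a q)) *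
            factorialPow a k (x (j + 1))) =
        Matrix.of fun i j : Fin n => ∑ k ∈ Finset.Icc (μ (i + 2)) (μ (i + 1)),
          (∏ q ∈ Finset.Ico k (μ (i + 1)), (x (n + 1) + a (n + 1 + q - i))) *
            factorialPow a (k + staircase n (i + 1)) (x (j + 1)) := by
      ext i j
      simp only [Matrix.of_apply, hstair]
      have e : Finset.Icc (μ (i + 2)) (μ (i + 1)) = Finset.Ico (μ (i + 2)) (μ (i + 1) + 1) := rfl
      rw [e, ← add_assoc, add_right_comm, ← Finset.sum_Ico_add' _ (μ (i + 2)) _ (n - (i : ℕ))]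
      refine Finset.sum_congr rfl fun k _ => ?_
      have e' : Finset.Ioo (k + (n - i)) (μ (i + 1) + 1 + (n - i)) =
          Finset.Ico (k + (n - i + 1)) (μ (i + 1) + (n - i + 1)) := by
        ext q
        simp only [Finset.mem_Ioo, Finset.mem_Ico]
        omega
      rw [e', ← Finset.prod_Ico_add' _ k _ (n - (i : ℕ) + 1)]
      congr 1
      refine Finset.prod_congr rfl fun q _ => ?_
      rw [show q + (n - i + 1) = n + 1 + q - i by omega]
    -- The last staircase part is `1`; its extra factor `x (n + 1) + a 0` is `x (n + 1)` because `a
    -- 0 = 0`.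
    have hlast : factorialPow a (μ (n + 1) + staircase (n + 1) (n + 1)) (x (n + 1)) =
        x (n + 1) * ∏ j ∈ Finset.range (μ (n + 1)), (x (n + 1) + a (j + 1)) := by
      rw [show staircase (n + 1) (n + 1) = 1 by unfold staircase; omega, factorialPow,
        Finset.prod_range_succ', ha, add_zero, mul_comm]
    rw [hdet, det_sum_mul _ _ fun i k j => factorialPow a (k + staircase n (i + 1)) (x (j + 1)),
      hlast, pairProd_succ, Finset.prod_Icc_succ_top (by omega), Finset.mul_sum, Finset.mul_sum]
    refine Finset.sum_congr rfl fun ν hν => ?_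
    have h := ih (antitoneOn_seqOf hν)
    rw [alternant] at h
    simp only [seqOf_succ] at h
    rw [← h]
    ring

end

/-! ### Base change and cancellation of the Vandermonde product -/

section

variable {R S : Type*} [CommRing R] [CommRing S] (φ : R →+* S)

theorem map_truthValue (P : Prop) : φ (truthValue R P) = truthValue S P := by
  unfold truthValue
  split_ifs <;> simp

theorem GTPattern.map_weight {n : ℕ} (G : GTPattern n) (x y a : ℕ → R) :
    φ (G.weight x y a) = G.weight (φ ∘ x) (φ ∘ y) (φ ∘ a) := by
  simp [GTPattern.weight, map_truthValue]

theorem map_factorialSchur (μ : YoungDiagram) (n : ℕ) (x a : ℕ → R) :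
    φ (factorialSchur μ n x a) = factorialSchur μ n (φ ∘ x) (φ ∘ a) := by
  simp [factorialSchur]

/-- Over `ℤ` the polynomial ring is a domain and distinct variables differ, so this product can be
cancelled. -/
theorem pairProd_sub_X_ne_zero {σ : Type*} {f : ℕ → σ} (hf : Function.Injective f) (n : ℕ) :
    pairProd n (fun i j => (MvPolynomial.X (f i) - MvPolynomial.X (f j) : MvPolynomial σ ℤ)) ≠
      0 := by
  refine Finset.prod_ne_zero_iff.2 fun i _ => Finset.prod_ne_zero_iff.2 fun j hj => ?_
  rw [sub_ne_zero]
  intro h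
  exact (Finset.mem_Ioc.1 hj).1.ne (hf (MvPolynomial.X_injective h))

theorem pairProd_mul_patternSum_eq (n : ℕ) (lam : ℕ → ℕ)
    (hstrict : StrictAntiOn lam (Set.Icc 1 n)) (hpos : ∀ i ∈ Set.Icc 1 n, 0 < lam i)
    (x y a : ℕ → R) (ha : a 0 = 0) :
    pairProd n (fun i j => x i - x j) * ∑ G : StrictGT n lam, G.1.weight x y a =
      pairProd n (fun i j => x i - x j) * ((∏ i ∈ Finset.Icc 1 n, x i) *
        (∏ i ∈ Finset.Icc 1 n, ∏ j ∈ Finset.Ioc i n, (x i + y j)) *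
        factorialSchur (diagramOf n (subStaircase n lam) (subStaircase_antitone hstrict))
          n x a) := by
  have h1 := pairProd_mul_patternSum x y a n hstrict.antitoneOn
  have h2 := pairProd_mul_schurSeq x a ha n (subStaircase_antitone hstrict)
  have h3 : (alternant a x n fun i => subStaircase n lam i + staircase n i) =
      alternant a x n lam := by
    unfold alternant
    congr 1
    ext i j
    simp only [Matrix.of_apply]
    rw [subStaircase_add hstrict hpos (i + 1) ⟨by omega, by omega⟩]
  rw [h3, schurSeq, dif_pos (subStaircase_antitone hstrict)] at h2
  rw [← h2, patternSum] at h1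
  rw [h1]
  unfold pairProd
  ring

end

theorem mainTheorem4 {R : Type*} [CommRing R] (n : ℕ) (lam : ℕ → ℕ)
    (hstrict : StrictAntiOn lam (Set.Icc 1 n)) (hpos : ∀ i ∈ Set.Icc 1 n, 0 < lam i)
    (x y a : ℕ → R) (ha : a 0 = 0) :
    ∑ G : StrictGT n lam, G.1.weight x y a =
      (∏ i ∈ Finset.Icc 1 n, x i) *
        (∏ i ∈ Finset.Icc 1 n, ∏ j ∈ Finset.Ioc i n, (x i + y j)) *
        factorialSchur (diagramOf n (subStaircase n lam) (subStaircase_antitone hstrict))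
          n x a := by
  -- The universal case: the index in `Fin 3` separates the families `x`, `y`, `a`. Setting `Z 0 =
  -- 0` keeps the hypothesis on `a 0` while the other variables stay free.
  let A := MvPolynomial (Fin 3 × ℕ) ℤ
  let X : ℕ → A := fun i => MvPolynomial.X (0, i)
  let Y : ℕ → A := fun i => MvPolynomial.X (1, i)
  let Z : ℕ → A := fun k => if k = 0 then 0 else MvPolynomial.X (2, k)
  let φ : A →+* R := MvPolynomial.eval₂Hom (Int.castRingHom R) fun p => ![x, y, a] p.1 p.2
  have hX : φ ∘ X = x := by
    funext i
    exact MvPolynomial.eval₂Hom_X' _ _ _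
  have hY : φ ∘ Y = y := by
    funext i
    exact MvPolynomial.eval₂Hom_X' _ _ _
  have hZ : φ ∘ Z = a := by
    funext k
    by_cases hk : k = 0
    · simp [Z, hk, ha]
    · simp only [Function.comp_apply, Z, hk, if_false]
      exact MvPolynomial.eval₂Hom_X' _ _ _
  have hgen := mul_left_cancel₀
    (pairProd_sub_X_ne_zero (f := fun i : ℕ => ((0 : Fin 3), i)) (fun _ _ h => by simpa using h) n)
    (pairProd_mul_patternSum_eq n lam hstrict hpos X Y Z (if_pos rfl))
  have h := congrArg φ hgen
  have hx : ∀ i, φ (X i) = x i := congrFun hX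
  have hy : ∀ i, φ (Y i) = y i := congrFun hY
  simpa only [map_sum, map_mul, map_prod, map_add, GTPattern.map_weight, map_factorialSchur, hX,
    hY, hZ, hx, hy] using h
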